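/- Let $p$ be an odd prime and let $S=(s_1,\dots,s_n)$ be a finite sequence of nonzero elements of $\mathbb{Z}/p\mathbb{Z}$, repetitions allowed. Write \[\Sigma(S)=\Big\{\sum_{i\in I}s_i : I\subseteq\{1,\dots,n\}\Big\},\qquad \Sigma^*(S)=\Big\{\sum_{i\in I}s_i : \emptyset\neq I\subseteq\{1,\dots,n\}\Big\}.\] For each pair $\{x,-x\}$ such that $x$ or $-x$ is a term of $S$, define its common multiplicity as the sum of the multiplicities of $x$ and of $-x$ in $S$. Let $l_1\geqslant l_2\geqslant\dots\geqslant l_d$ be the common multiplicities of all the (distinct) pairs $\{x,-x\}$ occurring in $S$, listed in non-increasing order (one entry for each pair). Then \[|\Sigma(S)|\geqslant\min\Big\{p,\,1+\sum_{i=1}^d i\,l_i\Big\}\qquad\text{and}\qquad|\Sigma^*(S)|\geqslant\min\Big\{p,\,\sum_{i=1}^d i\,l_i\Big\}.\] -/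

import Mathlib

/-- The multiplicity of `x` in the finite sequence `S`. -/
def seqMultiplicity {G : Type*} [DecidableEq G] {n : ℕ} (S : Fin n → G) (x : G) : ℕ :=
  (Finset.univ.filter (fun i => S i = x)).card

/-- The set `Σ(S)` of all subsums `∑_{i ∈ I} s_i`, where `I` is any subset of the index set
(the empty set included). -/
def subsums {G : Type*} [AddCommGroup G] [DecidableEq G] {n : ℕ} (S : Fin n → G) : Finset G :=
  (Finset.univ : Finset (Finset (Fin n))).image (fun I => ∑ i ∈ I, S i)

/-- The set `Σ*(S)` of non-trivial subsums `∑_{i ∈ I} s_i`, where `I` is any nonempty subset of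
the index set. -/
def nontrivialSubsums {G : Type*} [AddCommGroup G] [DecidableEq G] {n : ℕ} (S : Fin n → G) :
    Finset G :=
  ((Finset.univ : Finset (Finset (Fin n))).filter (fun I => I.Nonempty)).image
    (fun I => ∑ i ∈ I, S i)

/-- The pairs `{x, -x}` that occur in `S`, i.e. those for which `x` or `-x` is a term of `S`;
each pair is taken once. -/
def oppositePairs {G : Type*} [AddCommGroup G] [DecidableEq G] {n : ℕ} (S : Fin n → G) :
    Finset (Finset G) :=
  Finset.univ.image (fun i => ({S i, -S i} : Finset G))

/-- The multiset of all common multiplicities of `S`: each pair `{x, -x}` occurring in `S`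
contributes the sum of the multiplicities in `S` of its elements. -/
def commonMultiplicities {G : Type*} [AddCommGroup G] [DecidableEq G] {n : ℕ} (S : Fin n → G) :
    Multiset ℕ :=
  (oppositePairs S).val.map (fun P => ∑ x ∈ P, seqMultiplicity S x)

/-!
The bound is first proved for a sequence `a` of `d` elements of `ℤ/pℤ` that are nonzero and pairwise
distinct up to sign, where it reads `1 + d (d + 1) / 2` for all subsums and `d (d + 1) / 2` for the
nonempty ones. The general case follows by layers: choosing one term for every pair `{x, -x}` that
occurs in the sequence and removing these terms lowers every common multiplicity by one, and the
Cauchy-Davenport theorem adds up the contributions of the layers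
(`min_le_card_subsumsOn_of_coloring`).

For the special case, subsums of `a` correspond to the sums `± a 1 ± ⋯ ± a d`, that is, to the
values of `X 1 + ⋯ + X d` on those points of `(A ∪ -A) ^ d` at which
`V = ∏ (X i ^ 2 - X j ^ 2)` does not vanish. If there were at most `M` of them, then
`V * ∏ (X 1 + ⋯ + X d - s)`, with `M` factors, would vanish on any box inside `(A ∪ -A) ^ d`,
against the combinatorial Nullstellensatz as soon as a suitable coefficient of
`V * (X 1 + ⋯ + X d) ^ M` is nonzero modulo `p`. Boxes of sizes `d + q`, with `q` running over
`0, …, d` without `r`, have the right total size for `M = d (d + 1) / 2 - r`. If `r ≠ 0`, the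
value `q = 0` occurs, and the coordinate with the box `A` guarantees a nonempty subsum.

The coefficient depends neither on `a` nor on the `s`, so that it may be studied on
`{1, …, d}`, with boxes `{-d, …, -1} ∪ {1, …, q}`. There the sums form an arithmetic progression
with `M + 1` terms, and its largest term is attained exactly once. With the factors chosen to
vanish at all other terms, the polynomial is nonzero at exactly one point of the box, which forces
the coefficient to be nonzero (`coeff_ne_zero_of_existsUnique_eval_ne_zero`,
`coeff_squareVandermonde_mul_sum_pow_ne_zero`).
-/

open MvPolynomial

/-! ### Coefficients and values on boxes -/

/-- Subtracting constants from the linear factors does not change the coefficients of top degree. -/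
theorem coeff_mul_prod_sub_C {σ ι R : Type*} [CommRing R] (T : Finset ι)
    (L : ι → MvPolynomial σ R) (hL : ∀ k ∈ T, (L k).totalDegree ≤ 1) (c : ι → R)
    (V : MvPolynomial σ R) (t : σ →₀ ℕ) (ht : V.totalDegree + T.card ≤ t.degree) :
    (V * ∏ k ∈ T, (L k - C (c k))).coeff t = (V * ∏ k ∈ T, L k).coeff t := by
  classical
  induction T using Finset.induction_on generalizing V with
  | empty => simp
  | insert a T ha ih =>
    rw [Finset.card_insert_of_notMem ha] at ht
    have hLa : (L a).totalDegree ≤ 1 := hL a (Finset.mem_insert_self _ _)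
    have hLT : ∀ k ∈ T, (L k).totalDegree ≤ 1 := fun k hk => hL k (Finset.mem_insert_of_mem hk)
    have hVL : (V * L a).totalDegree ≤ V.totalDegree + 1 :=
      (totalDegree_mul _ _).trans (by omega)
    have hlow : (V * ∏ k ∈ T, (L k - C (c k))).coeff t = 0 := by
      apply coeff_eq_zero_of_totalDegree_lt
      have hprod : (∏ k ∈ T, (L k - C (c k))).totalDegree ≤ T.card := by
        refine (totalDegree_finsetProd _ _).trans ?_
        refine (Finset.sum_le_card_nsmul _ _ 1 fun k hk => ?_).trans (by simp)
        exact (totalDegree_sub_C_le _ _).trans (hLT k hk)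
      have := totalDegree_mul V (∏ k ∈ T, (L k - C (c k)))
      change _ < t.degree
      omega
    rw [Finset.prod_insert ha, Finset.prod_insert ha, ← mul_assoc V (L a),
      ← ih hLT (V * L a) (by omega)]
    have hsplit : V * ((L a - C (c a)) * ∏ k ∈ T, (L k - C (c k))) =
        V * L a * ∏ k ∈ T, (L k - C (c k)) - C (c a) * (V * ∏ k ∈ T, (L k - C (c k))) := by
      ring
    rw [hsplit, coeff_sub, coeff_C_mul, hlow, mul_zero, sub_zero]

/-- The converse use of the combinatorial Nullstellensatz: if exactly one point of a box with
side lengths `t i + 1` is not a zero of `f`, then the coefficient of `X ^ t` in `f` is nonzero.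
Were it zero, subtracting from `f` the Lagrange polynomial of that point would give a polynomial
vanishing on the box whose coefficient of `X ^ t` is nonzero. -/
theorem coeff_ne_zero_of_existsUnique_eval_ne_zero {σ F : Type*} [Fintype σ] [Field F]
    (f : MvPolynomial σ F) (t : σ →₀ ℕ) (hf : f.totalDegree ≤ t.degree) (B : σ → Finset F)
    (hB : ∀ i, (B i).card = t i + 1) (x₀ : σ → F) (hx₀ : ∀ i, x₀ i ∈ B i)
    (hne : eval x₀ f ≠ 0) (huniq : ∀ x : σ → F, (∀ i, x i ∈ B i) → eval x f ≠ 0 → x = x₀) :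
    f.coeff t ≠ 0 := by
  classical
  intro hzero
  set K : Finset (Σ _ : σ, F) := Finset.univ.sigma fun i => (B i).erase (x₀ i) with hK
  set Q : MvPolynomial σ F := ∏ k ∈ K, (X k.1 - C k.2) with hQ
  have hcard : ∀ i, ((B i).erase (x₀ i)).card = t i := fun i => by
    rw [Finset.card_erase_of_mem (hx₀ i), hB]; rfl
  have hKcard : K.card = t.degree := by
    rw [hK, Finset.card_sigma, Finsupp.degree_eq_sum]
    exact Finset.sum_congr rfl fun i _ => hcard i
  have hQt : Q.coeff t = 1 := by
    have h := coeff_mul_prod_sub_C K (fun k => (X k.1 : MvPolynomial σ F))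
      (fun k _ => (totalDegree_X _).le) (fun k => k.2) 1 t (by simp [hKcard])
    rw [one_mul, one_mul] at h
    rw [hQ, h, hK, Finset.prod_sigma]
    have : ∏ i : σ, ∏ _y ∈ (B i).erase (x₀ i), (X i : MvPolynomial σ F) = monomial t 1 := by
      rw [monomial_eq, C_1, one_mul, Finsupp.prod_fintype _ _ (fun i => pow_zero _)]
      exact Finset.prod_congr rfl fun i _ => by rw [Finset.prod_const, hcard]
    rw [this, coeff_monomial, if_pos rfl]
  have hQdeg : Q.totalDegree ≤ t.degree := by
    rw [← hKcard]
    refine (totalDegree_finsetProd _ _).trans ?_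
    refine (Finset.sum_le_card_nsmul _ _ 1 fun k _ => ?_).trans (by simp)
    exact (totalDegree_sub_C_le _ _).trans (totalDegree_X _).le
  have hevalQ : ∀ x, eval x Q = ∏ i, ∏ y ∈ (B i).erase (x₀ i), (x i - y) := fun x => by
    rw [hQ, hK, Finset.prod_sigma, map_prod]
    exact Finset.prod_congr rfl fun i _ => by simp [map_prod]
  have hQ₀ : eval x₀ Q ≠ 0 := by
    rw [hevalQ]
    refine Finset.prod_ne_zero_iff.2 fun i _ => Finset.prod_ne_zero_iff.2 fun y hy => ?_
    exact sub_ne_zero.2 (Finset.ne_of_mem_erase hy).symm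
  set g : MvPolynomial σ F := C (eval x₀ Q) * f - C (eval x₀ f) * Q with hg
  have hgt : g.coeff t ≠ 0 := by
    rw [hg, coeff_sub, coeff_C_mul, coeff_C_mul, hzero, hQt]
    simpa using hne
  have hgle : g.totalDegree ≤ t.degree := by
    refine (totalDegree_sub _ _).trans (max_le ?_ ?_)
    · exact (totalDegree_mul _ _).trans (by simpa using hf)
    · exact (totalDegree_mul _ _).trans (by simpa using hQdeg)
  have hgdeg : g.totalDegree = t.degree := by
    refine le_antisymm hgle (not_lt.1 fun h => hgt ?_)
    exact coeff_eq_zero_of_totalDegree_lt h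
  obtain ⟨x, hx, hgx⟩ := combinatorial_nullstellensatz_exists_eval_nonzero g t hgt hgdeg B
    (fun i => by rw [hB]; exact Nat.lt_succ_self _)
  apply hgx
  by_cases hxx : x = x₀
  · rw [hxx, hg]
    simp only [map_sub, map_mul, eval_C]
    ring
  · have h1 : eval x f = 0 := by
      by_contra h
      exact hxx (huniq x hx h)
    have h2 : eval x Q = 0 := by
      obtain ⟨i, hi⟩ := Function.ne_iff.1 hxx
      rw [hevalQ]
      refine Finset.prod_eq_zero (Finset.mem_univ i) ?_
      exact Finset.prod_eq_zero (Finset.mem_erase.2 ⟨hi, hx i⟩) (sub_self _)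
    rw [hg, map_sub, map_mul, map_mul, h1, h2]
    ring

/-! ### The Vandermonde product of squares -/

/-- The product of all `X i ^ 2 - X j ^ 2` with `i < j`; it is nonzero at a point exactly when the
coordinates of the point are pairwise distinct up to sign. -/
noncomputable def squareVandermonde (R : Type*) [CommRing R] (d : ℕ) :
    MvPolynomial (Fin d) R :=
  ∏ i, ∏ j ∈ Finset.Ioi i, (X i ^ 2 - X j ^ 2)

theorem totalDegree_squareVandermonde_le (R : Type*) [CommRing R] [Nontrivial R] (d : ℕ) :
    (squareVandermonde R d).totalDegree ≤ d * (d - 1) := by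
  have hfac : ∀ i j : Fin d, (X i ^ 2 - X j ^ 2 : MvPolynomial (Fin d) R).totalDegree ≤ 2 :=
    fun i j => (totalDegree_sub _ _).trans (by simp [totalDegree_X_pow])
  have hrow : ∀ i : Fin d, (∏ j ∈ Finset.Ioi i,
      (X i ^ 2 - X j ^ 2 : MvPolynomial (Fin d) R)).totalDegree ≤ (d - 1 - i) * 2 := fun i => by
    refine (totalDegree_finsetProd _ _).trans ?_
    refine (Finset.sum_le_card_nsmul _ _ 2 fun j _ => hfac i j).trans ?_
    simp [Fin.card_Ioi]
  refine (totalDegree_finsetProd _ _).trans ((Finset.sum_le_sum fun i _ => hrow i).trans ?_)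
  rw [← Finset.sum_mul, Fin.sum_univ_eq_sum_range (fun i => d - 1 - i),
    Finset.sum_range_reflect (fun i => i), Finset.sum_range_id_mul_two]

theorem eval_squareVandermonde_ne_zero_iff {F : Type*} [Field F] {d : ℕ} (x : Fin d → F) :
    eval x (squareVandermonde F d) ≠ 0 ↔ ∀ i j, i ≠ j → x i ≠ x j ∧ x i ≠ -x j := by
  have hsq : ∀ i j, x i ^ 2 - x j ^ 2 ≠ 0 ↔ x i ≠ x j ∧ x i ≠ -x j := fun i j => by
    rw [sub_ne_zero, Ne, sq_eq_sq_iff_eq_or_eq_neg, not_or]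
  simp only [squareVandermonde, map_prod, Finset.prod_ne_zero_iff, Finset.mem_univ,
    Finset.mem_Ioi, forall_true_left, map_sub, map_pow, eval_X, hsq]
  refine ⟨fun h i j hij => ?_, fun h i j hij => h i j hij.ne⟩
  rcases lt_or_gt_of_ne hij with hlt | hlt
  · exact h i j hlt
  · exact ⟨(h j i hlt).1.symm, fun e => (h j i hlt).2 (by rw [e, neg_neg])⟩

/-! ### The coefficient, evaluated on an arithmetic progression -/

theorem sum_succAbove_add {d : ℕ} (r : Fin (d + 1)) :
    ∑ i, (r.succAbove i : ℕ) + r = d * (d + 1) / 2 := by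
  have h := Fin.sum_univ_succAbove (fun j : Fin (d + 1) => (j : ℕ)) r
  rw [add_comm, ← h, Fin.sum_univ_eq_sum_range (fun i => i), Finset.sum_range_id,
    Nat.add_sub_cancel, mul_comm]

theorem sum_natAbs_of_injective {d : ℕ} (z : Fin d → ℤ) (hz : ∀ i, z i ≠ 0)
    (hzd : ∀ i, (z i).natAbs ≤ d) (hinj : Function.Injective fun i => (z i).natAbs) :
    ∑ i, (z i).natAbs = d * (d + 1) / 2 := by
  have himg : (Finset.univ.image fun i => (z i).natAbs) = (Finset.range (d + 1)).erase 0 := by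
    apply Finset.eq_of_subset_of_card_le
    · intro k hk
      obtain ⟨i, -, rfl⟩ := Finset.mem_image.1 hk
      have := hz i
      have := hzd i
      simp only [Finset.mem_erase, Finset.mem_range]
      omega
    · rw [Finset.card_image_of_injective _ hinj]
      simp
  have h : ∑ i, (z i).natAbs = ∑ k ∈ (Finset.range (d + 1)).erase 0, k := by
    rw [← himg, Finset.sum_image fun i _ j _ hij => hinj hij]
  rw [h, Finset.sum_erase (f := fun k => k) _ rfl, Finset.sum_range_id,
    Nat.add_sub_cancel, mul_comm]

/-- Signed permutations of `1, …, d` bounded above by the numbers `0, …, d` other than `r` have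
sum at most `d (d + 1) / 2 - 2 r`, and only one of them attains it: the positive terms equal their
bounds, and a term whose bound is `0` is `-r`. -/
theorem eq_of_le_sum_of_le_succAbove {d : ℕ} (r : Fin (d + 1)) (z : Fin d → ℤ)
    (hz : ∀ i, z i ≠ 0) (hzd : ∀ i, (z i).natAbs ≤ d) (hzr : ∀ i, z i ≤ (r.succAbove i : ℕ))
    (hinj : Function.Injective fun i => (z i).natAbs)
    (hsum : ((d * (d + 1) / 2 : ℕ) : ℤ) - 2 * (r : ℕ) ≤ ∑ i, z i) (i : Fin d) :
    z i = if (r.succAbove i : ℕ) = 0 then -((r : ℕ) : ℤ) else ((r.succAbove i : ℕ) : ℤ) := by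
  have hD := sum_natAbs_of_injective z hz hzd hinj
  have hq := sum_succAbove_add r
  set D := d * (d + 1) / 2
  have hD' : ∑ i, ((z i).natAbs : ℤ) = D := by exact_mod_cast hD
  have hq' : ∑ i, ((r.succAbove i : ℕ) : ℤ) + (r : ℕ) = D := by exact_mod_cast hq
  -- twice the sum of the positive parts is the sum of all terms and of all absolute values
  have hpos : 2 * ∑ i, max (z i) 0 = D + ∑ i, z i := by
    rw [← hD', Finset.mul_sum, ← Finset.sum_add_distrib]
    exact Finset.sum_congr rfl fun i _ => by omega
  have hle : ∀ i ∈ Finset.univ, max (z i) 0 ≤ ((r.succAbove i : ℕ) : ℤ) :=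
    fun i _ => max_le (hzr i) (by positivity)
  have hsumle := Finset.sum_le_sum hle
  have heq := (Finset.sum_eq_sum_iff_of_le hle).1 (by linarith)
  have hval : ∀ j, (r.succAbove j : ℕ) ≠ 0 → z j = ((r.succAbove j : ℕ) : ℤ) := fun j hj => by
    have := heq j (Finset.mem_univ j)
    omega
  split_ifs with hi
  · have hrest : ∑ j ∈ Finset.univ.erase i, z j =
        ∑ j ∈ Finset.univ.erase i, ((r.succAbove j : ℕ) : ℤ) := by
      refine Finset.sum_congr rfl fun j hj => hval j fun hj0 => Finset.ne_of_mem_erase hj ?_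
      exact r.succAbove_right_injective (Fin.ext (hj0.trans hi.symm))
    have h1 := Finset.add_sum_erase Finset.univ z (Finset.mem_univ i)
    have h2 := Finset.add_sum_erase Finset.univ (fun j => ((r.succAbove j : ℕ) : ℤ))
      (Finset.mem_univ i)
    simp only [hi] at h2
    push_cast at h2
    linarith
  · exact hval i hi

theorem ZMod.intCast_ne_zero_of_abs_lt {p : ℕ} {a : ℤ} (ha : a ≠ 0) (hp : |a| < p) :
    (a : ZMod p) ≠ 0 := fun h =>
  ha (Int.eq_zero_of_abs_lt_dvd ((ZMod.intCast_zmod_eq_zero_iff_dvd a p).1 h) hp)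

/-- The coefficient on which the argument rests. It is evaluated on the set `{1, …, d}`, for which
the sums `± 1 ± ⋯ ± d` form an arithmetic progression: the linear factors are taken to vanish at
all these sums below the largest one that the box allows. -/
theorem coeff_squareVandermonde_mul_sum_pow_ne_zero (p : ℕ) [Fact p.Prime] {d : ℕ}
    (hd : 2 * d < p) (r : Fin (d + 1)) {M : ℕ} (hM : M + r = d * (d + 1) / 2) (hMp : M < p)
    (t : Fin d →₀ ℕ) (ht : ∀ i, t i = d - 1 + r.succAbove i)
    (htdeg : d * (d - 1) + M ≤ t.degree) :
    (squareVandermonde (ZMod p) d * (∑ i, X i) ^ M).coeff t ≠ 0 := by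
  classical
  have hqd : ∀ i, (r.succAbove i : ℕ) ≤ d := fun i => Nat.le_of_lt_succ (r.succAbove i).2
  have hq := sum_succAbove_add r
  set D := d * (d + 1) / 2 with hDdef
  set c : ℕ → ZMod p := fun k => ((D - 2 * k : ℤ) : ZMod p) with hc
  have hV := totalDegree_squareVandermonde_le (ZMod p) d
  have hX : (∑ i : Fin d, (X i : MvPolynomial (Fin d) (ZMod p))).totalDegree ≤ 1 :=
    totalDegree_finsetSum_le fun i _ => (totalDegree_X _).le
  have hcard : (Finset.Ioc (r : ℕ) D).card = M := by rw [Nat.card_Ioc]; omega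
  have hcoeff := coeff_mul_prod_sub_C (Finset.Ioc (r : ℕ) D)
    (fun _ => (∑ i : Fin d, (X i : MvPolynomial (Fin d) (ZMod p)))) (fun _ _ => hX) c
    (squareVandermonde (ZMod p) d) t (by omega)
  rw [Finset.prod_const, hcard] at hcoeff
  rw [← hcoeff]
  set f := squareVandermonde (ZMod p) d * ∏ k ∈ Finset.Ioc (r : ℕ) D,
    (∑ i : Fin d, (X i : MvPolynomial (Fin d) (ZMod p)) - C (c k)) with hf
  have hfdeg : f.totalDegree ≤ t.degree := by
    refine (totalDegree_mul _ _).trans ((add_le_add hV ?_).trans htdeg)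
    refine (totalDegree_finsetProd _ _).trans ?_
    refine (Finset.sum_le_card_nsmul _ _ 1 fun k _ => ?_).trans (by simp [hcard])
    exact (totalDegree_sub_C_le _ _).trans hX
  have hfeval : ∀ x, eval x f ≠ 0 ↔ (∀ i j, i ≠ j → x i ≠ x j ∧ x i ≠ -x j) ∧
      ∀ k, (r : ℕ) < k → k ≤ D → ∑ i, x i - c k ≠ 0 := fun x => by
    rw [hf, map_mul, mul_ne_zero_iff, eval_squareVandermonde_ne_zero_iff, map_prod,
      Finset.prod_ne_zero_iff]
    simp
  -- the only point of the box at which the sum reaches its maximum `D - 2 r`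
  set z₀ : Fin d → ℤ := fun i =>
    if (r.succAbove i : ℕ) = 0 then -((r : ℕ) : ℤ) else ((r.succAbove i : ℕ) : ℤ) with hz₀
  have hrq : ∀ i, (r.succAbove i : ℕ) ≠ r := fun i h => r.succAbove_ne i (Fin.ext h)
  have hz₀sum : ∑ i, z₀ i = D - 2 * (r : ℕ) := by
    have hsplit : ∀ i, z₀ i = ((r.succAbove i : ℕ) : ℤ) -
        if (r.succAbove i : ℕ) = 0 then ((r : ℕ) : ℤ) else 0 := fun i => by
      simp only [hz₀]
      split_ifs <;> omega
    have hite : (∑ i, if (r.succAbove i : ℕ) = 0 then ((r : ℕ) : ℤ) else 0) = (r : ℕ) := by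
      by_cases hr : r = 0
      · simp [hr]
      · obtain ⟨i, hi⟩ := Fin.exists_succAbove_eq (Ne.symm hr)
        rw [Finset.sum_eq_single i]
        · simp [hi]
        · exact fun j _ hj => if_neg fun h => hj
            (r.succAbove_right_injective (hi.symm ▸ Fin.ext h))
        · simp
    rw [Finset.sum_congr rfl fun i _ => hsplit i, Finset.sum_sub_distrib, hite]
    have : ∑ i, ((r.succAbove i : ℕ) : ℤ) + (r : ℕ) = D := by exact_mod_cast hq
    linarith
  refine coeff_ne_zero_of_existsUnique_eval_ne_zero f t hfdeg
    (fun i => ((Finset.Icc (-(d : ℤ)) (r.succAbove i : ℕ)).erase 0).image fun z : ℤ => (z : ZMod p))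
    (fun i => ?_) (fun i => ((z₀ i : ℤ) : ZMod p)) (fun i => ?_) ?_ fun x hx hfx => ?_
  · rw [Finset.card_image_of_injOn, Finset.card_erase_of_mem, Int.card_Icc, ht]
    · have := i.pos
      omega
    · simp
    · intro y hy w hw hyw
      simp only [Finset.coe_erase, Finset.coe_Icc, Set.mem_sdiff, Set.mem_Icc] at hy hw
      by_contra hne
      refine ZMod.intCast_ne_zero_of_abs_lt (p := p) (sub_ne_zero.2 hne) ?_ (by
        push_cast; exact sub_eq_zero.2 hyw)
      have := hqd i
      rw [abs_lt]
      omega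
  · refine Finset.mem_image_of_mem _ ?_
    have := hqd i
    have := hrq i
    have := r.is_le
    simp only [hz₀, Finset.mem_erase, Finset.mem_Icc]
    split_ifs <;> omega
  · rw [hfeval]
    refine ⟨fun i j hij => ?_, fun k hk hkD => ?_⟩
    · have hqij : (r.succAbove i : ℕ) ≠ r.succAbove j := fun h =>
        hij (r.succAbove_right_injective (Fin.ext h))
      have h1 := hqd i
      have h2 := hqd j
      have h3 := hrq i
      have h4 := hrq j
      have h5 := r.is_le
      have hsub : z₀ i - z₀ j ≠ 0 ∧ |z₀ i - z₀ j| < p ∧ z₀ i + z₀ j ≠ 0 ∧ |z₀ i + z₀ j| < p := by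
        simp only [hz₀, abs_lt]
        split_ifs <;> omega
      refine ⟨fun h => ZMod.intCast_ne_zero_of_abs_lt hsub.1 hsub.2.1 ?_,
        fun h => ZMod.intCast_ne_zero_of_abs_lt hsub.2.2.1 hsub.2.2.2 ?_⟩
      · push_cast
        exact sub_eq_zero.2 h
      · push_cast
        rw [h, neg_add_cancel]
    · have h2 : ((2 : ℤ) : ZMod p) ≠ 0 := by
        apply ZMod.intCast_ne_zero_of_abs_lt two_ne_zero
        have hd0 : d ≠ 0 := by
          rintro rfl
          simp at hDdef
          omega
        rw [abs_lt]
        omega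
      have hkr : (((k : ℤ) - (r : ℕ) : ℤ) : ZMod p) ≠ 0 := by
        apply ZMod.intCast_ne_zero_of_abs_lt
        · omega
        · rw [abs_lt]; omega
      rw [← Int.cast_sum, hz₀sum, hc]
      intro h
      apply mul_ne_zero h2 hkr
      push_cast at h ⊢
      linear_combination h
  · have hz : ∀ i, ∃ z : ℤ, (z ≠ 0 ∧ -(d : ℤ) ≤ z ∧ z ≤ (r.succAbove i : ℕ)) ∧
        (z : ZMod p) = x i := fun i => by simpa using hx i
    choose z hz hzx using hz
    obtain ⟨hdist, hsum⟩ := (hfeval x).1 hfx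
    have habs : ∀ i, (z i).natAbs ≤ d := fun i => by
      have := hz i
      have := hqd i
      omega
    have hinj : Function.Injective fun i => (z i).natAbs := fun i j hij => by
      by_contra hne
      obtain ⟨h1, h2⟩ := hdist i j hne
      rw [← hzx, ← hzx] at h1 h2
      rcases Int.natAbs_eq_natAbs_iff.1 hij with h | h
      · exact h1 (by rw [h])
      · exact h2 (by rw [h]; push_cast; rfl)
    have hD := sum_natAbs_of_injective z (fun i => (hz i).1) habs hinj
    have hlarge : (D : ℤ) - 2 * (r : ℕ) ≤ ∑ i, z i := by
      -- `k` is the absolute value of the sum of the negative terms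
      set k := ∑ i, (-z i).toNat with hk
      have hkz : ∑ i, z i = D - 2 * (k : ℤ) := by
        rw [hDdef, ← hD, hk, Nat.cast_sum, Nat.cast_sum, Finset.mul_sum,
          ← Finset.sum_sub_distrib]
        exact Finset.sum_congr rfl fun i _ => by omega
      have hkD : k ≤ D := by
        rw [hDdef, ← hD]
        exact Finset.sum_le_sum fun i _ => by omega
      by_contra hlt
      refine hsum k (by omega) hkD ?_
      rw [hc, Finset.sum_congr rfl fun i _ => (hzx i).symm, ← Int.cast_sum, hkz, sub_self]
    funext i
    rw [← hzx i, eq_of_le_sum_of_le_succAbove r z (fun i => (hz i).1) habs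
      (fun i => (hz i).2.2) hinj hlarge i]

/-! ### Elements pairwise distinct up to sign -/

/-- The elements `± a j`, where the sign `-` is allowed only for the first `q` indices `j`. -/
def signedBox {G : Type*} [DecidableEq G] [Neg G] {d : ℕ} (a : Fin d → G) (q : ℕ) : Finset G :=
  Finset.univ.image a ∪ (Finset.univ.filter fun j : Fin d => (j : ℕ) < q).image fun j => -a j

theorem card_signedBox {G : Type*} [DecidableEq G] [AddGroup G] {d : ℕ} {a : Fin d → G}
    (ha : Function.Injective a) (hneg : ∀ i j, a i ≠ -a j) {q : ℕ} (hq : q ≤ d) :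
    (signedBox a q).card = d + q := by
  rw [signedBox, Finset.card_union_of_disjoint, Finset.card_image_of_injective _ ha,
    Finset.card_image_of_injective (f := fun j => -a j) _ (neg_injective.comp ha),
    Finset.card_univ, Fintype.card_fin, Fin.card_filter_val_lt, min_eq_right hq]
  rw [Finset.disjoint_left]
  intro x hx hx'
  obtain ⟨i, -, rfl⟩ := Finset.mem_image.1 hx
  obtain ⟨j, -, hj⟩ := Finset.mem_image.1 hx'
  exact hneg i j hj.symm

theorem two_mul_lt_of_ne_neg {p : ℕ} [Fact p.Prime] {d : ℕ} {a : Fin d → ZMod p}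
    (ha : Function.Injective a) (hneg : ∀ i j, a i ≠ -a j) : 2 * d < p := by
  have h0 : (0 : ZMod p) ∉ signedBox a d := by
    have ha0 : ∀ i, a i ≠ 0 := fun i h => hneg i i (by rw [h, neg_zero])
    simp [signedBox, ha0]
  have := Finset.card_lt_univ_of_notMem h0
  rw [card_signedBox ha hneg le_rfl, ZMod.card] at this
  omega

/-- The polynomial step. The index `r` prescribes the box sizes: the number of elements that may
be taken with the sign `-` runs over `0, …, d` without `r`. If `r ≠ 0`, then one coordinate has
no negative choice, so that only nonempty subsums of `a` arise. -/
theorem lt_card_of_subsums_mem {p : ℕ} [Fact p.Prime] {d : ℕ} {a : Fin d → ZMod p}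
    (ha : Function.Injective a) (hneg : ∀ i j, a i ≠ -a j) (r : Fin (d + 1)) {M : ℕ}
    (hM : M + r = d * (d + 1) / 2) (hMp : M < p) (A : Finset (ZMod p))
    (hA : ∀ I : Finset (Fin d), (r ≠ 0 → I.Nonempty) → ∑ i ∈ I, a i ∈ A) :
    M < A.card := by
  classical
  by_contra! hcard
  -- the sums of the points of the box are the images of the subsums under `y ↦ 2 y - ∑ a`
  obtain ⟨T, hT, hTcard⟩ := Finset.exists_superset_card_eq
    (s := A.image fun y => 2 * y - ∑ i, a i) (n := M) (Finset.card_image_le.trans hcard)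
    (by rw [ZMod.card]; exact hMp.le)
  have hqd : ∀ i, (r.succAbove i : ℕ) ≤ d := fun i => Nat.le_of_lt_succ (r.succAbove i).2
  set t : Fin d →₀ ℕ := Finsupp.equivFunOnFinite.symm fun i => d - 1 + r.succAbove i with ht
  have ht' : ∀ i, t i = d - 1 + r.succAbove i := fun i => rfl
  have htdeg : t.degree = d * (d - 1) + M := by
    rw [Finsupp.degree_eq_sum, Finset.sum_congr rfl fun i _ => ht' i, Finset.sum_add_distrib]
    have := sum_succAbove_add r
    simp only [Finset.sum_const, Finset.card_univ, Fintype.card_fin, smul_eq_mul]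
    omega
  have hV := totalDegree_squareVandermonde_le (ZMod p) d
  have hX : (∑ i : Fin d, (X i : MvPolynomial (Fin d) (ZMod p))).totalDegree ≤ 1 :=
    totalDegree_finsetSum_le fun i _ => (totalDegree_X _).le
  have hcoeff := coeff_mul_prod_sub_C T
    (fun _ => (∑ i : Fin d, (X i : MvPolynomial (Fin d) (ZMod p)))) (fun _ _ => hX) id
    (squareVandermonde (ZMod p) d) t (by omega)
  rw [Finset.prod_const, hTcard] at hcoeff
  have hne := coeff_squareVandermonde_mul_sum_pow_ne_zero p (two_mul_lt_of_ne_neg ha hneg) r hM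
    hMp t ht' htdeg.ge
  rw [← hcoeff] at hne
  have hfdeg : (squareVandermonde (ZMod p) d * ∏ k ∈ T,
      (∑ i : Fin d, (X i : MvPolynomial (Fin d) (ZMod p)) - C (id k))).totalDegree = t.degree := by
    refine le_antisymm ?_ (not_lt.1 fun h => hne (coeff_eq_zero_of_totalDegree_lt h))
    rw [htdeg]
    refine (totalDegree_mul _ _).trans (add_le_add hV ?_)
    refine (totalDegree_finsetProd _ _).trans ?_
    refine (Finset.sum_le_card_nsmul _ _ 1 fun k _ => ?_).trans (by simp [hTcard])
    exact (totalDegree_sub_C_le _ _).trans hX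
  obtain ⟨x, hx, hfx⟩ := combinatorial_nullstellensatz_exists_eval_nonzero _ t hne hfdeg
    (fun i => signedBox a (r.succAbove i)) fun i => by
      rw [card_signedBox ha hneg (hqd i), ht']
      have := i.pos
      omega
  rw [map_mul, mul_ne_zero_iff, eval_squareVandermonde_ne_zero_iff, map_prod,
    Finset.prod_ne_zero_iff] at hfx
  obtain ⟨hdist, hsum⟩ := hfx
  have hσ : ∀ i, ∃ j, x i = a j ∨ x i = -a j ∧ (j : ℕ) < r.succAbove i := fun i => by
    have h := hx i
    simp only [signedBox, Finset.mem_union, Finset.mem_image, Finset.mem_univ, true_and,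
      Finset.mem_filter] at h
    rcases h with ⟨j, hj⟩ | ⟨j, hj, hj'⟩
    · exact ⟨j, Or.inl hj.symm⟩
    · exact ⟨j, Or.inr ⟨hj'.symm, hj⟩⟩
  choose σ hσ using hσ
  have hσinj : Function.Injective σ := fun i j hij => by
    by_contra hne
    obtain ⟨h1, h2⟩ := hdist i j hne
    rcases hσ i with hi | ⟨hi, -⟩ <;> rcases hσ j with hj | ⟨hj, -⟩ <;>
      simp [hi, hj, hij] at h1 h2
  set e := Equiv.ofBijective σ (Finite.injective_iff_bijective.1 hσinj) with he
  have heσ : ∀ i, e i = σ i := fun i => rfl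
  set I : Finset (Fin d) := Finset.univ.filter fun j => x (e.symm j) = a j with hI
  have hxI : ∑ i, x i = 2 * ∑ j ∈ I, a j - ∑ j, a j := by
    rw [← Equiv.sum_comp e.symm, hI, Finset.sum_filter, Finset.mul_sum, ← Finset.sum_sub_distrib]
    refine Finset.sum_congr rfl fun j _ => ?_
    have hj := hσ (e.symm j)
    rw [← heσ, e.apply_symm_apply] at hj
    split_ifs with h
    · rw [h]; ring
    · rw [(hj.resolve_left h).1]; ring
  have hmem : ∑ j ∈ I, a j ∈ A := by
    refine hA I fun hr => ?_
    obtain ⟨i, hi⟩ := Fin.exists_succAbove_eq (Ne.symm hr)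
    refine ⟨e i, Finset.mem_filter.2 ⟨Finset.mem_univ _, ?_⟩⟩
    rw [e.symm_apply_apply, heσ]
    refine (hσ i).resolve_right fun h => ?_
    simp [hi] at h
  refine hsum _ (hT (Finset.mem_image_of_mem _ hmem)) ?_
  simp [hxI]

/-! ### Subsums over finite index sets -/

/-- The set of sums of `s` over the subsets of `U`. -/
def subsumsOn {ι G : Type*} [AddCommMonoid G] [DecidableEq G] (s : ι → G) (U : Finset ι) :
    Finset G :=
  U.powerset.image fun I => ∑ i ∈ I, s i

/-- The set of sums of `s` over the nonempty subsets of `U`. -/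
def nontrivialSubsumsOn {ι G : Type*} [AddCommMonoid G] [DecidableEq G] (s : ι → G)
    (U : Finset ι) : Finset G :=
  (U.powerset.filter Finset.Nonempty).image fun I => ∑ i ∈ I, s i

section Subsums

variable {ι G : Type*} [AddCommMonoid G] [DecidableEq G] (s : ι → G)

theorem mem_subsumsOn {U : Finset ι} {y : G} :
    y ∈ subsumsOn s U ↔ ∃ I ⊆ U, ∑ i ∈ I, s i = y := by
  simp [subsumsOn]

theorem mem_nontrivialSubsumsOn {U : Finset ι} {y : G} :
    y ∈ nontrivialSubsumsOn s U ↔ ∃ I ⊆ U, I.Nonempty ∧ ∑ i ∈ I, s i = y := by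
  simp [nontrivialSubsumsOn, and_assoc]

theorem nontrivialSubsumsOn_subset_subsumsOn (U : Finset ι) :
    nontrivialSubsumsOn s U ⊆ subsumsOn s U :=
  Finset.image_subset_image (Finset.filter_subset _ _)

theorem nontrivialSubsumsOn_mono {U W : Finset ι} (h : U ⊆ W) :
    nontrivialSubsumsOn s U ⊆ nontrivialSubsumsOn s W := fun y hy => by
  obtain ⟨I, hI, hne, rfl⟩ := (mem_nontrivialSubsumsOn s).1 hy
  exact (mem_nontrivialSubsumsOn s).2 ⟨I, hI.trans h, hne, rfl⟩

open scoped Pointwise in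
theorem subsumsOn_add_subset [DecidableEq ι] {J U : Finset ι} (h : J ⊆ U) :
    subsumsOn s J + subsumsOn s (U \ J) ⊆ subsumsOn s U := fun y hy => by
  obtain ⟨a, ha, b, hb, rfl⟩ := Finset.mem_add.1 hy
  obtain ⟨I, hI, rfl⟩ := (mem_subsumsOn s).1 ha
  obtain ⟨K, hK, rfl⟩ := (mem_subsumsOn s).1 hb
  refine (mem_subsumsOn s).2 ⟨I ∪ K,
    Finset.union_subset (hI.trans h) (hK.trans Finset.sdiff_subset), ?_⟩
  exact Finset.sum_union (Finset.disjoint_of_subset_left hI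
    (Finset.disjoint_of_subset_right hK Finset.disjoint_sdiff))

open scoped Pointwise in
theorem nontrivialSubsumsOn_add_subset [DecidableEq ι] {J U : Finset ι} (h : J ⊆ U) :
    nontrivialSubsumsOn s J + subsumsOn s (U \ J) ⊆ nontrivialSubsumsOn s U := fun y hy => by
  obtain ⟨a, ha, b, hb, rfl⟩ := Finset.mem_add.1 hy
  obtain ⟨I, hI, hne, rfl⟩ := (mem_nontrivialSubsumsOn s).1 ha
  obtain ⟨K, hK, rfl⟩ := (mem_subsumsOn s).1 hb
  refine (mem_nontrivialSubsumsOn s).2 ⟨I ∪ K,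
    Finset.union_subset (hI.trans h) (hK.trans Finset.sdiff_subset),
    hne.mono Finset.subset_union_left, ?_⟩
  exact Finset.sum_union (Finset.disjoint_of_subset_left hI
    (Finset.disjoint_of_subset_right hK Finset.disjoint_sdiff))

end Subsums

/-- `lt_card_of_subsums_mem` for a family indexed by a finite set. -/
theorem lt_card_of_sum_mem {ι : Type*} {p : ℕ} [Fact p.Prime] {s : ι → ZMod p} {J : Finset ι}
    (hinj : Set.InjOn s J) (hneg : ∀ i ∈ J, ∀ j ∈ J, s i ≠ -s j) {r M : ℕ} (hr : r ≤ J.card)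
    (hM : M + r = J.card * (J.card + 1) / 2) (hMp : M < p) (A : Finset (ZMod p))
    (hA : ∀ I ⊆ J, (r ≠ 0 → I.Nonempty) → ∑ i ∈ I, s i ∈ A) :
    M < A.card := by
  classical
  set e := J.equivFin.symm
  refine lt_card_of_subsums_mem (a := fun i => s (e i))
    (fun i j hij => e.injective (Subtype.ext (hinj (e i).2 (e j).2 hij)))
    (fun i j => hneg _ (e i).2 _ (e j).2) ⟨r, Nat.lt_succ_of_le hr⟩ hM hMp A fun I hI => ?_
  have hmap : ∑ i ∈ I, s (e i) =
      ∑ i ∈ I.map (e.toEmbedding.trans (Function.Embedding.subtype _)), s i := by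
    rw [Finset.sum_map]; rfl
  rw [hmap]
  refine hA _ (fun i hi => ?_) fun h => ?_
  · obtain ⟨k, -, rfl⟩ := Finset.mem_map.1 hi
    exact (e k).2
  · rw [Finset.map_nonempty]
    exact hI fun h0 => h (congrArg Fin.val h0)

/-- The bound for nonempty subsums of elements that are pairwise distinct up to sign. Elements are
dropped as long as the bound stays at least `p`; afterwards the parameter `r` of
`lt_card_of_sum_mem` can be chosen so that `M + 1` is the bound. -/
theorem min_le_card_nontrivialSubsumsOn {ι : Type*} {p : ℕ} [Fact p.Prime] {s : ι → ZMod p}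
    {J : Finset ι} (hinj : Set.InjOn s J) (hneg : ∀ i ∈ J, ∀ j ∈ J, s i ≠ -s j) :
    min p (J.card * (J.card + 1) / 2) ≤ (nontrivialSubsumsOn s J).card := by
  classical
  have hp : 0 < p := (Fact.out : p.Prime).pos
  induction J using Finset.induction_on with
  | empty => simp
  | insert a J ha ih =>
    set W := insert a J with hW
    have hJW : J ⊆ W := Finset.subset_insert a J
    have hcard : W.card = J.card + 1 := Finset.card_insert_of_notMem ha
    have hstep : W.card * (W.card + 1) / 2 = J.card * (J.card + 1) / 2 + W.card := by
      rw [hcard, ← Nat.add_mul_div_right _ _ two_pos]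
      congr 1
      ring
    have key : ∀ r M : ℕ, r ≠ 0 → r ≤ W.card → M + r = W.card * (W.card + 1) / 2 → M < p →
        M < (nontrivialSubsumsOn s W).card := fun r M hr0 hr hM hMp =>
      lt_card_of_sum_mem hinj hneg hr hM hMp _ fun I hI hne =>
        (mem_nontrivialSubsumsOn s).2 ⟨I, hI, hne hr0, rfl⟩
    by_cases hlarge : p ≤ J.card * (J.card + 1) / 2
    · have h := ih (hinj.mono (by exact_mod_cast hJW))
        fun i hi j hj => hneg i (hJW hi) j (hJW hj)
      rw [min_eq_left hlarge] at h
      exact (min_le_left _ _).trans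
        (h.trans (Finset.card_le_card (nontrivialSubsumsOn_mono s hJW)))
    · by_cases hsmall : W.card * (W.card + 1) / 2 ≤ p
      · have := key 1 (W.card * (W.card + 1) / 2 - 1) one_ne_zero (by omega) (by omega) (by omega)
        omega
      · have := key (W.card * (W.card + 1) / 2 - (p - 1)) (p - 1) (by omega) (by omega)
          (by omega) (by omega)
        omega

/-- As long as the bound is at most `p`, it is the case `r = 0` of `lt_card_of_sum_mem`;
beyond that, the nonempty subsums alone already fill `ℤ/pℤ`. -/
theorem min_le_card_subsumsOn {ι : Type*} {p : ℕ} [Fact p.Prime] {s : ι → ZMod p}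
    {J : Finset ι} (hinj : Set.InjOn s J) (hneg : ∀ i ∈ J, ∀ j ∈ J, s i ≠ -s j) :
    min p (1 + J.card * (J.card + 1) / 2) ≤ (subsumsOn s J).card := by
  by_cases hD : J.card * (J.card + 1) / 2 < p
  · have := lt_card_of_sum_mem hinj hneg (r := 0) (Nat.zero_le _) (add_zero _) hD
      (subsumsOn s J) fun I hI _ => (mem_subsumsOn s).2 ⟨I, hI, rfl⟩
    omega
  · have h1 := min_le_card_nontrivialSubsumsOn hinj hneg
    have h2 := Finset.card_le_card (nontrivialSubsumsOn_subset_subsumsOn s J)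
    omega

/-! ### Decomposition into layers -/

theorem sum_val_add_one_of_isLowerSet {d : ℕ} {K : Finset (Fin d)}
    (hK : ∀ j ∈ K, ∀ i ≤ j, i ∈ K) :
    ∑ k ∈ K, (k.val + 1) = K.card * (K.card + 1) / 2 := by
  have hmap : K.map Fin.valEmbedding = Finset.range K.card := by
    refine Finset.eq_of_subset_of_card_le (fun n hn => ?_) (by simp)
    obtain ⟨k, hk, rfl⟩ := Finset.mem_map.1 hn
    have hle := Finset.card_le_card fun i hi => hK k hk i (Finset.mem_Iic.1 hi)
    rw [Fin.card_Iic] at hle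
    exact Finset.mem_range.2 hle
  have hsum : ∑ k ∈ K, (k.val + 1) = ∑ n ∈ Finset.range K.card, (n + 1) := by
    rw [← hmap, Finset.sum_map]
    rfl
  have hshift := Finset.sum_range_succ' (fun n => n) K.card
  rw [hsum, ← add_zero (∑ n ∈ Finset.range K.card, (n + 1)), ← hshift, Finset.sum_range_id,
    Nat.add_sub_cancel, mul_comm]

open scoped Pointwise in
/-- The bounds for a family `s` on `U` whose indices are coloured so that terms equal up to sign
have the same colour. Removing one index of every colour present lowers all nonzero class sizes by
one, and the Cauchy-Davenport theorem adds up the contributions of the removed sets. -/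
theorem min_le_card_subsumsOn_of_coloring {ι : Type*} {p : ℕ} [Fact p.Prime] {d : ℕ}
    {s : ι → ZMod p} (hs : ∀ i, s i ≠ -s i) {c : ι → Fin d}
    (hc : ∀ i j, s i = s j ∨ s i = -s j → c i = c j) (U : Finset ι)
    (hU : Antitone fun k => (U.filter fun i => c i = k).card) :
    min p (1 + ∑ k : Fin d, (k.val + 1) * (U.filter fun i => c i = k).card) ≤
        (subsumsOn s U).card ∧
      min p (∑ k : Fin d, (k.val + 1) * (U.filter fun i => c i = k).card) ≤
        (nontrivialSubsumsOn s U).card := by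
  classical
  have hp : p.Prime := Fact.out
  induction U using Finset.strongInduction with
  | H U ih =>
    rcases U.eq_empty_or_nonempty with rfl | hne
    · simp [subsumsOn]
    obtain ⟨J, hJU, hJinj, hJimg⟩ := Finset.exists_subset_injOn_image_eq_of_surjOn
      (U : Set ι) (U.image c) (f := c) (by simpa using Set.surjOn_image c U)
    set K := U.image c with hK
    have hJU' : J ⊆ U := by exact_mod_cast hJU
    have hJcard : J.card = K.card := by
      rw [← Finset.card_image_of_injOn hJinj]
      exact congrArg Finset.card hJimg
    have hmemK : ∀ k, k ∈ K ↔ (U.filter fun i => c i = k).card ≠ 0 := fun k => by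
      simp [hK, Finset.card_eq_zero, Finset.filter_eq_empty_iff]
    have hlower : ∀ j ∈ K, ∀ i ≤ j, i ∈ K := fun j hj i hij => by
      rw [hmemK] at hj ⊢
      have := hU hij
      simp only at this
      omega
    have hJfiber : ∀ k, (J.filter fun i => c i = k).card = if k ∈ K then 1 else 0 := fun k => by
      split_ifs with hk
      · rw [← show J.image c = K from hJimg] at hk
        obtain ⟨i, hi, rfl⟩ := Finset.mem_image.1 hk
        rw [Finset.card_eq_one]
        refine ⟨i, Finset.ext fun j => ?_⟩
        rw [Finset.mem_filter, Finset.mem_singleton]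
        exact ⟨fun h => hJinj h.1 hi h.2, fun h => by rw [h]; exact ⟨hi, rfl⟩⟩
      · rw [Finset.card_eq_zero, Finset.filter_eq_empty_iff]
        exact fun i hi h => hk (h ▸ Finset.mem_image_of_mem c (hJU' hi))
    have hfiber : ∀ k, (U.filter fun i => c i = k).card =
        ((U \ J).filter fun i => c i = k).card + if k ∈ K then 1 else 0 := fun k => by
      rw [← hJfiber, ← Finset.card_union_of_disjoint
        (Finset.disjoint_filter_filter Finset.sdiff_disjoint), ← Finset.filter_union,
        Finset.sdiff_union_of_subset hJU']
    have hanti : Antitone fun k => ((U \ J).filter fun i => c i = k).card := fun i j hij => by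
      have h1 := hU hij
      have h2 := hfiber i
      have h3 := hfiber j
      have h4 := hmemK j
      have h5 := hlower j
      simp only at h1 ⊢
      by_cases hj : j ∈ K
      · rw [if_pos hj] at h3
        rw [if_pos (h5 hj i hij)] at h2
        omega
      · have := not_not.1 (mt h4.2 hj)
        omega
    have hJne : J.Nonempty := by
      rw [← Finset.card_pos, hJcard, Finset.card_pos]
      exact hne.image c
    obtain ⟨ih1, -⟩ := ih (U \ J) (Finset.sdiff_ssubset hJU' hJne) hanti
    have hsum : ∑ k : Fin d, (k.val + 1) * (U.filter fun i => c i = k).card =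
        ∑ k : Fin d, (k.val + 1) * ((U \ J).filter fun i => c i = k).card +
          J.card * (J.card + 1) / 2 := by
      rw [hJcard, ← sum_val_add_one_of_isLowerSet hlower, Finset.sum_congr rfl fun k _ => by
        rw [hfiber k, mul_add], Finset.sum_add_distrib]
      simp
    have hinj : Set.InjOn s J := fun i hi j hj h => hJinj hi hj (hc i j (Or.inl h))
    have hneg : ∀ i ∈ J, ∀ j ∈ J, s i ≠ -s j := fun i hi j hj h => by
      have hij := hJinj hi hj (hc i j (Or.inr h))
      exact hs i (by rw [← hij] at h; exact h)
    have h1 := min_le_card_subsumsOn hinj hneg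
    have h2 := min_le_card_nontrivialSubsumsOn hinj hneg
    have hRne : (subsumsOn s (U \ J)).Nonempty :=
      ⟨0, (mem_subsumsOn s).2 ⟨∅, Finset.empty_subset _, Finset.sum_empty⟩⟩
    have hSne : (subsumsOn s J).Nonempty :=
      ⟨0, (mem_subsumsOn s).2 ⟨∅, Finset.empty_subset _, Finset.sum_empty⟩⟩
    have hNne : (nontrivialSubsumsOn s J).Nonempty := by
      obtain ⟨i, hi⟩ := hJne
      exact ⟨s i, (mem_nontrivialSubsumsOn s).2
        ⟨{i}, Finset.singleton_subset_iff.2 hi, Finset.singleton_nonempty i,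
          Finset.sum_singleton _ _⟩⟩
    have c1 := ZMod.cauchy_davenport hp hSne hRne
    have c2 := ZMod.cauchy_davenport hp hNne hRne
    have c3 := Finset.card_le_card (subsumsOn_add_subset s hJU')
    have c4 := Finset.card_le_card (nontrivialSubsumsOn_add_subset s hJU')
    have := hNne.card_pos
    rw [hsum]
    constructor <;> omega

/-! ### Common multiplicities -/

theorem insert_neg_eq_iff {G : Type*} [DecidableEq G] [InvolutiveNeg G] {x y : G} :
    ({x, -x} : Finset G) = {y, -y} ↔ x = y ∨ x = -y := by
  refine ⟨fun h => ?_, ?_⟩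
  · have hx : x ∈ ({y, -y} : Finset G) := h ▸ Finset.mem_insert_self _ _
    simpa using hx
  · rintro (rfl | rfl)
    · rfl
    · rw [neg_neg, Finset.pair_comm]

/-- The common multiplicity of a pair `{x, -x}` counts the indices whose pair it is. -/
theorem sum_seqMultiplicity_eq_card {G : Type*} [DecidableEq G] [AddCommGroup G] {n : ℕ}
    (S : Fin n → G) {P : Finset G} (hP : P ∈ oppositePairs S) :
    ∑ x ∈ P, seqMultiplicity S x =
      (Finset.univ.filter fun i => ({S i, -S i} : Finset G) = P).card := by
  simp only [seqMultiplicity]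
  rw [Finset.sum_card_fiberwise_eq_card_filter]
  obtain ⟨j, -, rfl⟩ := Finset.mem_image.1 hP
  congr 1
  ext i
  simp [insert_neg_eq_iff]

theorem exists_equiv_of_map_univ_eq_map {α β γ : Type*} [Fintype α] {f : α → γ} {P : Finset β}
    {g : β → γ} (h : (Finset.univ : Finset α).val.map f = P.val.map g) :
    ∃ e : α ≃ P, ∀ a, g (e a) = f a := by
  classical
  have hP : P.val.map g = (Finset.univ : Finset P).val.map fun b : P => g b.1 :=
    (Multiset.attach_map_val' P.val g).symm
  have hcard : ∀ m, Fintype.card {a // f a = m} = Fintype.card {b : P // g b = m} := fun m => by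
    have hm := congrArg (Multiset.count m) (h.trans hP)
    rw [Multiset.count_map, Multiset.count_map] at hm
    rw [Fintype.card_subtype, Fintype.card_subtype]
    simp only [eq_comm (a := m)] at hm
    exact hm
  exact ⟨Equiv.ofFiberEquiv (g := fun b : P => g b) fun m => Fintype.equivOfCardEq (hcard m),
    fun a => Equiv.ofFiberEquiv_map (g := fun b : P => g b) _ a⟩

theorem mainTheorem3 (p : ℕ) [Fact p.Prime] (hp : Odd p) (n : ℕ) (S : Fin n → ZMod p)
    (hS : ∀ i, S i ≠ 0) (d : ℕ) (l : Fin d → ℕ) (hl : Antitone l)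
    (hlS : (Finset.univ : Finset (Fin d)).val.map l = commonMultiplicities S) :
    min p (1 + ∑ i : Fin d, (i.val + 1) * l i) ≤ (subsums S).card ∧
      min p (∑ i : Fin d, (i.val + 1) * l i) ≤ (nontrivialSubsums S).card := by
  obtain ⟨e, he⟩ := exists_equiv_of_map_univ_eq_map hlS
  have hmem : ∀ i, ({S i, -S i} : Finset (ZMod p)) ∈ oppositePairs S := fun i =>
    Finset.mem_image_of_mem _ (Finset.mem_univ i)
  set c : Fin n → Fin d := fun i => e.symm ⟨{S i, -S i}, hmem i⟩ with hc
  have hfiber : ∀ k, (Finset.univ.filter fun i => c i = k).card = l k := fun k => by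
    rw [← he, sum_seqMultiplicity_eq_card S (e k).2]
    congr 1
    ext i
    simp [hc, Equiv.symm_apply_eq, Subtype.ext_iff]
  have hneg : ∀ i, S i ≠ -S i := fun i h => by
    rcases (ZMod.neg_eq_self_iff (S i)).1 h.symm with h0 | h0
    · exact hS i h0
    · obtain ⟨m, hm⟩ := hp
      omega
  have h := min_le_card_subsumsOn_of_coloring hneg (c := c)
    (fun i j hij => by simp only [hc, insert_neg_eq_iff.2 hij]) Finset.univ
    (by simpa only [hfiber] using hl)
  simp only [hfiber] at h
  simpa [subsums, nontrivialSubsums, subsumsOn, nontrivialSubsumsOn] using h
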